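/- Let $n, d_1,\dots,d_n$ be natural numbers, $d=d_1+\cdots+d_n$, and write $x\in\mathbb{R}^d$ in blocks as $x=(x_1,\dots,x_n)$ with $x_i\in\mathbb{R}^{d_i}$. Let $H\in\mathbb{R}^{d\times d}$ be symmetric and positive semidefinite, with blocks $H_{ij}\in\mathbb{R}^{d_i\times d_j}$, and let $g\in\mathbb{R}^d$. Assume that $H_{ii}\succ 0$ for $i=1,\dots,n$ and that the unconstrained quadratic problem $$\min_{x\in\mathbb{R}^d}\ \theta(x):=\tfrac12 x^\top Hx+g^\top x$$ has at least one optimal solution. Let $x^0\in\mathbb{R}^d$, and let $(x^k)_{k\ge 0}$ be generated from $x^0$ by randomly permuted block coordinate descent: at each iteration $k=0,1,2,\dots$ a permutation $\sigma=\sigma_k$ of $\{1,\dots,n\}$ is drawn uniformly at random, independently of the permutations of the other iterations, and then, successively for $i=1,\dots,n$, $$x_{\sigma(i)}^{k+1}:=\operatorname*{argmin}_{x_{\sigma(i)}\in\mathbb{R}^{d_{\sigma(i)}}}\ \theta\bigl(x_{\sigma(1)}^{k+1},\dots,x_{\sigma(i-1)}^{k+1},\,x_{\sigma(i)},\,x_{\sigma(i+1)}^{k},\dots,x_{\sigma(n)}^{k}\bigr),$$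 where the arguments of $\theta$ are listed in the order of $\sigma$, each standing for the block with its index. Then every $x^k$ is integrable, and the sequence of expectations $\mathbb{E}[x^k]$ converges, as $k\to\infty$, to an optimal solution of the problem. -/

import Mathlib

open MeasureTheory ProbabilityTheory Filter Topology
open scoped Matrix ENNReal

namespace RPBCD

/-- Vectors `x = (x_1, …, x_n)` with blocks `x_i ∈ ℝ^{d_i}`. -/
abbrev BlockVec {n : ℕ} (d : Fin n → ℕ) : Type := (i : Fin n) → Fin (d i) → ℝ

/-- The scalar coordinates of a block vector: pairs (block `i`, coordinate inside block `i`). -/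
abbrev Idx {n : ℕ} (d : Fin n → ℕ) : Type := (i : Fin n) × Fin (d i)

/-- The block vector as a single vector in `ℝ^d`, `d = d_1 + … + d_n`. -/
def flat {n : ℕ} {d : Fin n → ℕ} (x : BlockVec d) : Idx d → ℝ := fun p => x p.1 p.2

/-- The diagonal block `H_ii` of `H`. -/
def diagBlock {n : ℕ} {d : Fin n → ℕ} (H : Matrix (Idx d) (Idx d) ℝ) (i : Fin n) :
    Matrix (Fin (d i)) (Fin (d i)) ℝ :=
  Matrix.of fun a b => H ⟨i, a⟩ ⟨i, b⟩

/-- The objective `θ(x) = ½ xᵀ H x + gᵀ x`. -/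
noncomputable def objective {n : ℕ} {d : Fin n → ℕ} (H : Matrix (Idx d) (Idx d) ℝ)
    (g : BlockVec d) (x : BlockVec d) : ℝ :=
  (1 / 2 : ℝ) * (flat x ⬝ᵥ (H *ᵥ flat x)) + flat g ⬝ᵥ flat x

/-- `x` is an optimal solution of `min θ` over the whole space. -/
def IsOptimal {n : ℕ} {d : Fin n → ℕ} (H : Matrix (Idx d) (Idx d) ℝ)
    (g : BlockVec d) (x : BlockVec d) : Prop :=
  IsMinOn (objective H g) Set.univ x

/-- In a sweep from `x` to `y` in the block order `π 0, π 1, …, π (n-1)`, the point that is current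
just before block `π i` is updated: the blocks `π j` with `j < i` are already those of `y`, all
others are still those of `x`. -/
def current {n : ℕ} {d : Fin n → ℕ} (π : Equiv.Perm (Fin n)) (x y : BlockVec d) (i : Fin n) :
    BlockVec d :=
  fun b => if π.symm b < i then y b else x b

/-- `y` results from `x` by one sweep of block coordinate descent in the order `π`: for every
position `i`, the new block `y_{π(i)}` minimizes `θ` over block `π(i)`, with the blocks
`π(0), …, π(i-1)` at their new values and the blocks `π(i+1), …, π(n-1)` at their old values. -/
def IsSweep {n : ℕ} {d : Fin n → ℕ} (H : Matrix (Idx d) (Idx d) ℝ) (g : BlockVec d)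
    (π : Equiv.Perm (Fin n)) (x y : BlockVec d) : Prop :=
  ∀ i : Fin n,
    IsMinOn (fun u : Fin (d (π i)) → ℝ =>
        objective H g (Function.update (current π x y i) (π i) u))
      Set.univ (y (π i))

/-- The `σ k`, `k = 0, 1, 2, …`, are independent, uniformly distributed random permutations of
the `n` blocks. -/
structure IsUniformPermSeq {n : ℕ} {Ω : Type*} [MeasurableSpace Ω] (P : Measure Ω)
    (σ : ℕ → Ω → Equiv.Perm (Fin n)) : Prop where
  measurable : ∀ k, Measurable[_, ⊤] (σ k)
  uniform : ∀ k (π : Equiv.Perm (Fin n)), P {ω | σ k ω = π} = ((n.factorial : ℝ≥0∞))⁻¹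
  indep : iIndepFun (m := fun _ => (⊤ : MeasurableSpace (Equiv.Perm (Fin n)))) σ P

/-- The random sequence `x 0, x 1, …` is generated by randomly permuted block coordinate descent
from the initial point `x₀`: each iteration draws a fresh uniformly random permutation of the
blocks, and performs one sweep in that order. -/
structure IsRPBCD {n : ℕ} {d : Fin n → ℕ} (H : Matrix (Idx d) (Idx d) ℝ) (g : BlockVec d)
    {Ω : Type*} [MeasurableSpace Ω] (P : Measure Ω) (σ : ℕ → Ω → Equiv.Perm (Fin n))
    (x₀ : BlockVec d) (x : ℕ → Ω → BlockVec d) : Prop where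
  perms : IsUniformPermSeq P σ
  init : ∀ ω, x 0 ω = x₀
  step : ∀ k ω, IsSweep H g (σ k ω) (x k ω) (x (k + 1) ω)

end RPBCD

/-! Convergence holds path by path, with a rate common to all orders of the blocks. Because `H_ii`
is positive definite, exact block minimization makes the squared length of a sweep at most a
constant times the decrease of `θ` (`exists_sq_norm_sub_le`). Each block of the gradient vanishes
right after its update, so the gradient after the sweep is at most a constant times that length
(`exists_norm_grad_le`). Even for singular `H`, the gap of `θ` to its minimum is bounded by the
squared gradient (`exists_dotProduct_mulVec_le`). Chained, these contract the gap by a fixed factor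
per sweep, so steps shrink geometrically and every path converges to an optimal solution.

The deterministic rate bounds all iterates uniformly, so dominated convergence yields the
expectation of the random limit. It is optimal because the optimal solutions form the affine set `H
x = -g`. -/

namespace RPBCD

/-! ### Quadratic objective and first-order optimality -/

section Quadratic

variable {n : ℕ} {d : Fin n → ℕ}

/-- The gradient `H x + g` of the objective. -/
def grad (H : Matrix (Idx d) (Idx d) ℝ) (g x : BlockVec d) : Idx d → ℝ :=
  H *ᵥ flat x + flat g

lemma flat_add (x y : BlockVec d) : flat (x + y) = flat x + flat y := rfl

lemma flat_smul (t : ℝ) (x : BlockVec d) : flat (t • x) = t • flat x := rfl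

lemma norm_flat_le (x : BlockVec d) : ‖flat x‖ ≤ ‖x‖ :=
  (pi_norm_le_iff_of_nonneg (norm_nonneg _)).2 fun p =>
    (norm_le_pi_norm (x p.1) p.2).trans (norm_le_pi_norm x p.1)

lemma grad_add (H : Matrix (Idx d) (Idx d) ℝ) (g x w : BlockVec d) :
    grad H g (x + w) = grad H g x + H *ᵥ flat w := by
  simp only [grad, flat_add, Matrix.mulVec_add]; abel

lemma objective_add {H : Matrix (Idx d) (Idx d) ℝ} (hH : H.PosSemidef) (g x w : BlockVec d) :
    objective H g (x + w) = objective H g x + grad H g x ⬝ᵥ flat w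
      + (1 / 2 : ℝ) * (flat w ⬝ᵥ (H *ᵥ flat w)) := by
  have hsymm : flat x ⬝ᵥ (H *ᵥ flat w) = flat w ⬝ᵥ (H *ᵥ flat x) := by
    have hT : Hᵀ = H := (Matrix.conjTranspose_eq_transpose_of_trivial H).symm.trans hH.1
    rw [Matrix.dotProduct_mulVec, ← Matrix.mulVec_transpose, hT, dotProduct_comm]
  simp only [objective, grad, flat_add, Matrix.mulVec_add, add_dotProduct, dotProduct_add, hsymm,
    dotProduct_comm (H *ᵥ flat x) (flat w)]
  ring

lemma dotProduct_mulVec_self_nonneg {ι : Type*} [Fintype ι] {H : Matrix ι ι ℝ}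
    (hH : H.PosSemidef) (v : ι → ℝ) : 0 ≤ v ⬝ᵥ (H *ᵥ v) := by
  simpa using hH.dotProduct_mulVec_nonneg v

/-- The derivative vanishes along every line on which the point is a minimizer. -/
lemma grad_dotProduct_eq_zero {H : Matrix (Idx d) (Idx d) ℝ} (hH : H.PosSemidef)
    {g x w : BlockVec d} (h : ∀ t : ℝ, objective H g x ≤ objective H g (x + t • w)) :
    grad H g x ⬝ᵥ flat w = 0 := by
  set a := grad H g x ⬝ᵥ flat w with ha
  set q := (1 / 2 : ℝ) * (flat w ⬝ᵥ (H *ᵥ flat w)) with hq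
  have hq0 : 0 ≤ q := mul_nonneg (by norm_num) (dotProduct_mulVec_self_nonneg hH _)
  have key : ∀ t : ℝ, 0 ≤ t * a + t ^ 2 * q := by
    intro t
    have := h t
    rw [objective_add hH, flat_smul, Matrix.mulVec_smul, dotProduct_smul, dotProduct_smul,
      smul_dotProduct] at this
    simp only [smul_eq_mul] at this
    rw [ha, hq]
    linarith
  -- The `+ 1` keeps the denominator positive when `q = 0`; the value is still negative unless `a =
  -- 0`.
  have h1 := key (-a / (q + 1))
  have h2 : -a / (q + 1) * a + (-a / (q + 1)) ^ 2 * q = -(a / (q + 1)) ^ 2 := by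
    field_simp; ring
  rw [h2] at h1
  have h3 : a / (q + 1) = 0 := by
    have := sq_nonneg (a / (q + 1))
    exact pow_eq_zero_iff (two_ne_zero) |>.1 (by linarith)
  rcases div_eq_zero_iff.1 h3 with h4 | h4
  · exact h4
  · linarith

lemma isOptimal_iff_grad_eq_zero {H : Matrix (Idx d) (Idx d) ℝ} (hH : H.PosSemidef)
    {g x : BlockVec d} : IsOptimal H g x ↔ grad H g x = 0 := by
  constructor
  · intro h
    have := grad_dotProduct_eq_zero hH (g := g) (x := x)
      (w := fun i a => grad H g x ⟨i, a⟩) fun t => h (Set.mem_univ _)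
    exact dotProduct_self_eq_zero.1 this
  · intro h y _
    have := objective_add hH g x (y - x)
    rw [add_sub_cancel, h, zero_dotProduct] at this
    have h0 := dotProduct_mulVec_self_nonneg hH (flat (y - x))
    simp only [Set.mem_ofPred_eq]
    linarith

lemma objective_sub_of_isOptimal {H : Matrix (Idx d) (Idx d) ℝ} (hH : H.PosSemidef)
    {g z : BlockVec d} (hz : IsOptimal H g z) (x : BlockVec d) :
    objective H g x - objective H g z
      = (1 / 2 : ℝ) * (flat (x - z) ⬝ᵥ (H *ᵥ flat (x - z))) := by
  have := objective_add hH g z (x - z)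
  rw [add_sub_cancel, (isOptimal_iff_grad_eq_zero hH).1 hz, zero_dotProduct] at this
  linarith

lemma continuous_objective (H : Matrix (Idx d) (Idx d) ℝ) (g : BlockVec d) :
    Continuous (objective H g) := by
  have hf : Continuous (flat : BlockVec d → Idx d → ℝ) := by unfold flat; fun_prop
  unfold objective
  fun_prop

end Quadratic

/-! ### Norm bounds for matrices and quadratic forms -/

section Bounds

variable {ι : Type*} [Fintype ι]

lemma exists_norm_mulVec_le (H : Matrix ι ι ℝ) :
    ∃ C, 0 ≤ C ∧ ∀ v, ‖H *ᵥ v‖ ≤ C * ‖v‖ :=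
  ⟨_, norm_nonneg _, (Matrix.mulVecLin H).toContinuousLinearMap.le_opNorm⟩

lemma dotProduct_le_card_mul_norm (v w : ι → ℝ) : v ⬝ᵥ w ≤ Fintype.card ι * (‖v‖ * ‖w‖) := by
  calc v ⬝ᵥ w ≤ ∑ _i : ι, ‖v‖ * ‖w‖ := Finset.sum_le_sum fun i _ =>
        (le_abs_self _).trans <| by
          rw [abs_mul]
          exact mul_le_mul (norm_le_pi_norm v i) (norm_le_pi_norm w i) (abs_nonneg _)
            (norm_nonneg _)
    _ = _ := by simp

/-- A generalized inverse: a section of `f` over its range, extended to `W`. It replaces the inverse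
of `H` when `H` is singular. -/
lemma exists_linearMap_comp_comp_self {K V W : Type*} [Field K] [AddCommGroup V] [Module K V]
    [AddCommGroup W] [Module K W] (f : V →ₗ[K] W) :
    ∃ G : W →ₗ[K] V, ∀ v, f (G (f v)) = f v := by
  obtain ⟨s, hs⟩ := f.rangeRestrict.exists_rightInverse_of_surjective f.range_rangeRestrict
  obtain ⟨G, hG⟩ := s.exists_extend
  refine ⟨G, fun v => ?_⟩
  have h1 : G (f v) = s (f.rangeRestrict v) := LinearMap.congr_fun hG (f.rangeRestrict v)
  rw [h1]
  exact congrArg Subtype.val (LinearMap.congr_fun hs (f.rangeRestrict v))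

/-- A symmetric quadratic form is bounded by the square of its gradient. -/
lemma exists_dotProduct_mulVec_le {H : Matrix ι ι ℝ} (hH : H.PosSemidef) :
    ∃ C, 0 ≤ C ∧ ∀ v, v ⬝ᵥ (H *ᵥ v) ≤ C * ‖H *ᵥ v‖ ^ 2 := by
  obtain ⟨G, hG⟩ := exists_linearMap_comp_comp_self (Matrix.mulVecLin H)
  refine ⟨Fintype.card ι * ‖G.toContinuousLinearMap‖, by positivity, fun v => ?_⟩
  have hT : Hᵀ = H := (Matrix.conjTranspose_eq_transpose_of_trivial H).symm.trans hH.1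
  have hv : H *ᵥ G (H *ᵥ v) = H *ᵥ v := hG v
  -- By symmetry, `v · H G H v` depends on `v` only through `H v`.
  have h1 : v ⬝ᵥ (H *ᵥ v) = (H *ᵥ v) ⬝ᵥ G (H *ᵥ v) := by
    conv_lhs => rw [← hv]
    rw [Matrix.dotProduct_mulVec, ← Matrix.mulVec_transpose, hT]
  rw [h1]
  refine (dotProduct_le_card_mul_norm _ _).trans ?_
  have h2 : ‖G (H *ᵥ v)‖ ≤ ‖G.toContinuousLinearMap‖ * ‖H *ᵥ v‖ :=
    G.toContinuousLinearMap.le_opNorm _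
  calc (Fintype.card ι : ℝ) * (‖H *ᵥ v‖ * ‖G (H *ᵥ v)‖)
      ≤ Fintype.card ι * (‖H *ᵥ v‖ * (‖G.toContinuousLinearMap‖ * ‖H *ᵥ v‖)) := by gcongr
    _ = _ := by ring

/-- By homogeneity the unit sphere suffices; there the reciprocal of the form is continuous, hence
bounded by compactness. -/
lemma exists_sq_norm_le {A : Matrix ι ι ℝ} (hA : A.PosDef) :
    ∃ C, ∀ v, ‖v‖ ^ 2 ≤ C * (v ⬝ᵥ (A *ᵥ v)) := by
  have hpos : ∀ v : ι → ℝ, v ≠ 0 → 0 < v ⬝ᵥ (A *ᵥ v) := fun v hv => by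
    simpa using hA.dotProduct_mulVec_pos hv
  obtain ⟨C, hC⟩ := (isCompact_sphere (0 : ι → ℝ) 1).exists_bound_of_continuousOn
    (f := fun v => (v ⬝ᵥ (A *ᵥ v))⁻¹) (ContinuousOn.inv₀ (by fun_prop) fun v hv =>
      (hpos v (ne_zero_of_mem_unit_sphere ⟨v, hv⟩)).ne')
  refine ⟨C, fun v => ?_⟩
  rcases eq_or_ne v 0 with rfl | hv
  · simp
  have hn : 0 < ‖v‖ := norm_pos_iff.2 hv
  have h1 := hC (‖v‖⁻¹ • v) (by simp [norm_smul, hn.ne'])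
  have hq := hpos v hv
  have h2 : (‖v‖⁻¹ • v) ⬝ᵥ (A *ᵥ (‖v‖⁻¹ • v)) = (v ⬝ᵥ (A *ᵥ v)) / ‖v‖ ^ 2 := by
    rw [Matrix.mulVec_smul, dotProduct_smul, smul_dotProduct, smul_eq_mul, smul_eq_mul]
    field_simp
  have h3 : ‖v‖ ^ 2 / (v ⬝ᵥ (A *ᵥ v)) ≤ C := by
    rw [h2, inv_div] at h1
    exact (le_abs_self _).trans h1
  rwa [div_le_iff₀ hq] at h3

end Bounds

/-! ### One sweep: decrease, gradient bound, contraction, uniqueness -/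

section Sweep

variable {n : ℕ} {d : Fin n → ℕ} {H : Matrix (Idx d) (Idx d) ℝ} {g : BlockVec d}

/-- The point reached after the first `m` block updates of a sweep from `x` to `y`. -/
def partialSweep (π : Equiv.Perm (Fin n)) (x y : BlockVec d) (m : ℕ) : BlockVec d :=
  fun b => if (π.symm b : ℕ) < m then y b else x b

lemma partialSweep_zero (π : Equiv.Perm (Fin n)) (x y : BlockVec d) :
    partialSweep π x y 0 = x := by
  ext b; simp [partialSweep]

lemma partialSweep_last (π : Equiv.Perm (Fin n)) (x y : BlockVec d) :
    partialSweep π x y n = y := by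
  ext b; simp [partialSweep]

lemma update_current (π : Equiv.Perm (Fin n)) (x y : BlockVec d) (i : Fin n) :
    Function.update (current π x y i) (π i) (y (π i)) = partialSweep π x y (i + 1) := by
  funext b
  rcases eq_or_ne b (π i) with rfl | hb
  · simp [partialSweep]
  · have hne : (π.symm b : ℕ) ≠ i := fun h => hb (by
      rw [← Fin.ext h, Equiv.apply_symm_apply])
    have hiff : π.symm b < i ↔ (π.symm b : ℕ) < i + 1 := by
      rw [Fin.lt_def]; omega
    simp [partialSweep, Function.update_of_ne hb, current, hiff]

lemma update_eq_add_single (z : BlockVec d) (i : Fin n) (v u : Fin (d i) → ℝ) :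
    Function.update z i u = Function.update z i v + Pi.single i (u - v) := by
  funext b
  rcases eq_or_ne b i with rfl | hb
  · simp
  · simp [hb]

/-- The expansion is around the point after the update, where the gradient has no component in the
moved block. -/
lemma partialSweep_eq_add_single (π : Equiv.Perm (Fin n)) (x y : BlockVec d) (i : Fin n) :
    partialSweep π x y i
      = partialSweep π x y (i + 1) + Pi.single (π i) (x (π i) - y (π i)) := by
  rw [← update_current, ← update_eq_add_single]
  have h : current π x y i (π i) = x (π i) := by simp [current]
  rw [← h, Function.update_eq_self]
  rfl

lemma dotProduct_flat_single (v : Idx d → ℝ) (i : Fin n) (u : Fin (d i) → ℝ) :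
    v ⬝ᵥ flat (Pi.single i u : BlockVec d) = (fun a => v ⟨i, a⟩) ⬝ᵥ u := by
  simp only [dotProduct, Fintype.sum_sigma]
  rw [Finset.sum_eq_single i]
  · simp [flat]
  · intro b _ hb
    simp [flat, hb]
  · simp

lemma flat_single_dotProduct_mulVec (i : Fin n) (u : Fin (d i) → ℝ) :
    flat (Pi.single i u : BlockVec d) ⬝ᵥ (H *ᵥ flat (Pi.single i u : BlockVec d))
      = u ⬝ᵥ (diagBlock H i *ᵥ u) := by
  rw [dotProduct_comm, dotProduct_flat_single, dotProduct_comm]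
  congr 1
  funext a
  exact dotProduct_flat_single _ i u

lemma grad_partialSweep_eq_zero (hH : H.PosSemidef) {π : Equiv.Perm (Fin n)} {x y : BlockVec d}
    (h : IsSweep H g π x y) (i : Fin n) (u : Fin (d (π i)) → ℝ) :
    grad H g (partialSweep π x y (i + 1)) ⬝ᵥ flat (Pi.single (π i) u : BlockVec d) = 0 := by
  refine grad_dotProduct_eq_zero hH fun t => ?_
  have h1 := h i (Set.mem_univ (y (π i) + t • u))
  simp only [Set.mem_ofPred_eq] at h1
  rw [update_eq_add_single _ _ (y (π i)) (y (π i) + t • u), update_current] at h1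
  rwa [add_sub_cancel_left, Pi.single_smul] at h1

lemma objective_partialSweep (hH : H.PosSemidef) {π : Equiv.Perm (Fin n)} {x y : BlockVec d}
    (h : IsSweep H g π x y) (i : Fin n) (u : Fin (d (π i)) → ℝ) :
    objective H g (partialSweep π x y (i + 1) + Pi.single (π i) u)
      = objective H g (partialSweep π x y (i + 1))
        + (1 / 2 : ℝ) * (u ⬝ᵥ (diagBlock H (π i) *ᵥ u)) := by
  rw [objective_add hH, grad_partialSweep_eq_zero hH h, flat_single_dotProduct_mulVec, add_zero]

lemma objective_partialSweep_antitone (hH : H.PosSemidef)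
    (hHii : ∀ i : Fin n, (diagBlock H i).PosDef)
    {π : Equiv.Perm (Fin n)} {x y : BlockVec d} (h : IsSweep H g π x y) {l m : ℕ}
    (hlm : l ≤ m) (hm : m ≤ n) :
    objective H g (partialSweep π x y m) ≤ objective H g (partialSweep π x y l) := by
  induction m, hlm using Nat.le_induction with
  | base => exact le_rfl
  | succ m _ ih =>
    refine le_trans ?_ (ih (by omega))
    have h1 := objective_partialSweep hH h ⟨m, hm⟩ (x (π ⟨m, hm⟩) - y (π ⟨m, hm⟩))
    rw [← partialSweep_eq_add_single] at h1
    have h2 := dotProduct_mulVec_self_nonneg (hHii (π ⟨m, hm⟩)).posSemidef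
      (x (π ⟨m, hm⟩) - y (π ⟨m, hm⟩))
    simp only at h1
    linarith

/-- Sufficient decrease: the step length is controlled by the decrease of the objective. -/
lemma exists_sq_norm_sub_le (hH : H.PosSemidef) (hHii : ∀ i : Fin n, (diagBlock H i).PosDef)
    (g : BlockVec d) :
    ∃ C, 0 ≤ C ∧ ∀ (π : Equiv.Perm (Fin n)) (x y : BlockVec d), IsSweep H g π x y →
      ‖y - x‖ ^ 2 ≤ C * (objective H g x - objective H g y) := by
  choose c hc using fun i => exists_sq_norm_le (hHii i)
  obtain ⟨M, hM⟩ := Finite.exists_le c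
  -- The 2 cancels the `1 / 2` in `θ`; the maximum with 0 is needed since the `c i` carry no sign.
  refine ⟨2 * max M 0, by positivity, fun π x y h => ?_⟩
  have hmono := fun {l m : ℕ} => objective_partialSweep_antitone hH hHii h (l := l) (m := m)
  have hdec : 0 ≤ objective H g x - objective H g y := by
    have := hmono (Nat.zero_le n) le_rfl
    rw [partialSweep_zero, partialSweep_last] at this
    linarith
  rw [← Real.le_sqrt (norm_nonneg _) (by positivity)]
  -- In the sup norm one block at a time suffices, and the decrease in one update is at most that of
  -- the whole sweep.
  refine (pi_norm_le_iff_of_nonneg (Real.sqrt_nonneg _)).2 fun b => ?_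
  obtain ⟨i, rfl⟩ := π.surjective b
  rw [Real.le_sqrt (norm_nonneg _) (by positivity), Pi.sub_apply, norm_sub_rev]
  have h1 := objective_partialSweep hH h i (x (π i) - y (π i))
  rw [← partialSweep_eq_add_single] at h1
  have h2 := hmono (Nat.zero_le i) i.2.le
  have h3 := hmono (l := i + 1) i.2 le_rfl
  rw [partialSweep_zero] at h2
  rw [partialSweep_last] at h3
  have h4 := dotProduct_mulVec_self_nonneg (hHii (π i)).posSemidef (x (π i) - y (π i))
  calc ‖x (π i) - y (π i)‖ ^ 2
      ≤ c (π i) * _ := hc _ _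
    _ ≤ max M 0 * _ := mul_le_mul_of_nonneg_right ((hM _).trans (le_max_left _ _)) h4
    _ ≤ max M 0 * (2 * (objective H g x - objective H g y)) :=
        mul_le_mul_of_nonneg_left (by linarith) (le_max_right _ _)
    _ = _ := by ring

/-- The gradient after a sweep is controlled by the step length. -/
lemma exists_norm_grad_le (hH : H.PosSemidef) (g : BlockVec d) :
    ∃ C, 0 ≤ C ∧ ∀ (π : Equiv.Perm (Fin n)) (x y : BlockVec d), IsSweep H g π x y →
      ‖grad H g y‖ ≤ C * ‖y - x‖ := by
  obtain ⟨C, hC0, hC⟩ := exists_norm_mulVec_le H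
  refine ⟨C, hC0, fun π x y h => ?_⟩
  refine (pi_norm_le_iff_of_nonneg (by positivity)).2 fun ⟨b, a⟩ => ?_
  obtain ⟨i, rfl⟩ := π.surjective b
  set z := partialSweep π x y (i + 1) with hz
  have h0 : grad H g z ⟨π i, a⟩ = 0 := by
    have := grad_partialSweep_eq_zero hH h i (Pi.single a 1)
    rw [dotProduct_flat_single] at this
    simpa using this
  have h1 : grad H g y ⟨π i, a⟩ = (H *ᵥ flat (y - z)) ⟨π i, a⟩ := by
    have := congrFun (grad_add H g z (y - z)) ⟨π i, a⟩
    rwa [add_sub_cancel, Pi.add_apply, h0, zero_add] at this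
  rw [h1]
  refine (norm_le_pi_norm (H *ᵥ flat (y - z)) _).trans ((hC _).trans ?_)
  refine mul_le_mul_of_nonneg_left ((norm_flat_le _).trans ?_) hC0
  -- `y - z` agrees with `y - x` on the blocks not yet updated and is zero on the others.
  refine (pi_norm_le_iff_of_nonneg (norm_nonneg _)).2 fun b => ?_
  by_cases hb : (π.symm b : ℕ) < i + 1
  · simp [hz, partialSweep, hb]
  · simpa [hz, partialSweep, hb] using norm_le_pi_norm (y - x) b

/-- Linear convergence of the objective, with a rate that does not depend on the order. -/
lemma exists_objective_contraction (hH : H.PosSemidef)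
    (hHii : ∀ i : Fin n, (diagBlock H i).PosDef) {z : BlockVec d} (hz : IsOptimal H g z) :
    ∃ ρ, 0 ≤ ρ ∧ ρ < 1 ∧ ∀ (π : Equiv.Perm (Fin n)) (x y : BlockVec d), IsSweep H g π x y →
      objective H g y - objective H g z ≤ ρ * (objective H g x - objective H g z) := by
  obtain ⟨C, hC0, hC⟩ := exists_sq_norm_sub_le hH hHii g
  obtain ⟨D, hD0, hD⟩ := exists_norm_grad_le hH g
  obtain ⟨E, hE0, hE⟩ := exists_dotProduct_mulVec_le hH
  set K := (1 / 2 : ℝ) * (E * (D ^ 2 * C)) with hK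
  have hK0 : 0 ≤ K := by positivity
  -- With gaps `F`, solving `F y ≤ K (F x - F y)` for `F y` gives this factor.
  refine ⟨K / (1 + K), by positivity, (div_lt_one (by positivity)).2 (by linarith),
    fun π x y h => ?_⟩
  have hg : grad H g y = H *ᵥ flat (y - z) := by
    have := grad_add H g z (y - z)
    rwa [add_sub_cancel, (isOptimal_iff_grad_eq_zero hH).1 hz, zero_add] at this
  have h1 : objective H g y - objective H g z ≤ K * (objective H g x - objective H g y) := by
    calc objective H g y - objective H g z
        = (1 / 2 : ℝ) * (flat (y - z) ⬝ᵥ (H *ᵥ flat (y - z))) :=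
          objective_sub_of_isOptimal hH hz y
      _ ≤ (1 / 2 : ℝ) * (E * ‖grad H g y‖ ^ 2) := by rw [hg]; gcongr; exact hE _
      _ ≤ (1 / 2 : ℝ) * (E * (D * ‖y - x‖) ^ 2) := by gcongr; exact hD π x y h
      _ = (1 / 2 : ℝ) * (E * (D ^ 2 * ‖y - x‖ ^ 2)) := by ring
      _ ≤ (1 / 2 : ℝ) * (E * (D ^ 2 * (C * (objective H g x - objective H g y)))) := by
          gcongr; exact hC π x y h
      _ = _ := by rw [hK]; ring
  rw [div_mul_eq_mul_div, le_div_iff₀ (by positivity)]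
  linarith

/-- A sweep in a given order has at most one outcome. -/
lemma IsSweep.unique (hH : H.PosSemidef) (hHii : ∀ i : Fin n, (diagBlock H i).PosDef)
    {π : Equiv.Perm (Fin n)} {x y y' : BlockVec d} (h : IsSweep H g π x y)
    (h' : IsSweep H g π x y') : y = y' := by
  have key : ∀ i : Fin n, y (π i) = y' (π i) := by
    intro i
    induction i using WellFoundedLT.induction with
    | ind i ih =>
      have hcur : current π x y' i = current π x y i := by
        funext b
        obtain ⟨j, rfl⟩ := π.surjective b
        by_cases hj : j < i
        · simpa [current, hj] using (ih j hj).symm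
        · simp [current, hj]
      -- With equal current points, a different minimizer `y'` would exceed the value at `y` by a
      -- positive quadratic term.
      have h1 := h' i (Set.mem_univ (y (π i)))
      simp only [Set.mem_ofPred_eq, hcur] at h1
      rw [update_eq_add_single _ _ (y (π i)) (y' (π i)), update_current,
        objective_partialSweep hH h] at h1
      by_contra hne
      have h2 := (hHii (π i)).dotProduct_mulVec_pos (sub_ne_zero.2 (Ne.symm hne))
      simp only [star_trivial] at h2
      linarith
  funext b
  obtain ⟨i, rfl⟩ := π.surjective b
  exact key i

end Sweep

/-! ### Pathwise convergence, measurability, expectation of optimal points -/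

section Iterates

variable {n : ℕ} {d : Fin n → ℕ} {H : Matrix (Idx d) (Idx d) ℝ} {g : BlockVec d}

/-- The iterates of block coordinate descent, in any orders, converge to an optimal solution,
with a geometric rate that depends only on the problem and the initial point. -/
lemma exists_geometric_rate (hH : H.PosSemidef) (hHii : ∀ i : Fin n, (diagBlock H i).PosDef)
    (hopt : ∃ z : BlockVec d, IsOptimal H g z) (x₀ : BlockVec d) :
    ∃ A r, 0 ≤ A ∧ 0 ≤ r ∧ r < 1 ∧ ∀ (π : ℕ → Equiv.Perm (Fin n)) (x : ℕ → BlockVec d), x 0 = x₀ →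
      (∀ k, IsSweep H g (π k) (x k) (x (k + 1))) →
      (∀ k, dist (x k) (x (k + 1)) ≤ A * r ^ k) ∧
        ∃ xlim, IsOptimal H g xlim ∧ Tendsto x atTop (𝓝 xlim) := by
  obtain ⟨z, hz⟩ := hopt
  obtain ⟨C, hC0, hC⟩ := exists_sq_norm_sub_le hH hHii g
  obtain ⟨ρ, hρ0, hρ1, hρ⟩ := exists_objective_contraction hH hHii hz
  have hr1 : √ρ < 1 := by rw [Real.sqrt_lt' one_pos]; simpa using hρ1
  -- Squared steps are at most `C` times the gap, which decays like `ρ ^ k`; hence the square roots.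
  refine ⟨√(C * (objective H g x₀ - objective H g z)), √ρ, Real.sqrt_nonneg _,
    Real.sqrt_nonneg _, hr1, fun π x hx0 hx => ?_⟩
  have hzle : ∀ y, objective H g z ≤ objective H g y := fun y => hz (Set.mem_univ y)
  have hF : ∀ k, objective H g (x k) - objective H g z
      ≤ ρ ^ k * (objective H g x₀ - objective H g z) := by
    intro k
    induction k with
    | zero => simp [hx0]
    | succ k ih =>
      calc _ ≤ ρ * (objective H g (x k) - objective H g z) := hρ _ _ _ (hx k)
        _ ≤ ρ * (ρ ^ k * (objective H g x₀ - objective H g z)) := by gcongr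
        _ = _ := by ring
  have hstep : ∀ k, dist (x k) (x (k + 1))
      ≤ √(C * (objective H g x₀ - objective H g z)) * √ρ ^ k := by
    intro k
    have h0 : 0 ≤ C * (objective H g x₀ - objective H g z) :=
      mul_nonneg hC0 (sub_nonneg.2 (hzle _))
    rw [dist_comm, dist_eq_norm]
    refine le_of_sq_le_sq ?_ (by positivity)
    rw [mul_pow, ← pow_mul, mul_comm k 2, pow_mul, Real.sq_sqrt h0, Real.sq_sqrt hρ0]
    calc _ ≤ C * (objective H g (x k) - objective H g (x (k + 1))) := hC _ _ _ (hx k)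
      _ ≤ C * (objective H g (x k) - objective H g z) := by gcongr; exact hzle _
      _ ≤ C * (ρ ^ k * (objective H g x₀ - objective H g z)) := by gcongr; exact hF k
      _ = _ := by ring
  refine ⟨hstep, ?_⟩
  obtain ⟨w, hw⟩ := cauchySeq_tendsto_of_complete (cauchySeq_of_le_geometric _ _ hr1 hstep)
  refine ⟨w, fun y _ => ?_, hw⟩
  have h1 : Tendsto (fun k => objective H g (x k) - objective H g z) atTop
      (𝓝 (objective H g w - objective H g z)) :=
    (((continuous_objective H g).tendsto w).comp hw).sub_const _
  have h2 : Tendsto (fun k => ρ ^ k * (objective H g x₀ - objective H g z)) atTop (𝓝 0) := by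
    simpa using (tendsto_pow_atTop_nhds_zero_of_lt_one hρ0 hρ1).mul_const _
  have h3 := le_of_tendsto_of_tendsto' h1 h2 hF
  have h4 := hzle y
  simp only [Set.mem_ofPred_eq]
  linarith

lemma iterate_eq_of_perms_eq (hH : H.PosSemidef) (hHii : ∀ i : Fin n, (diagBlock H i).PosDef)
    {Ω : Type*} {σ : ℕ → Ω → Equiv.Perm (Fin n)} {x₀ : BlockVec d} {x : ℕ → Ω → BlockVec d}
    (hx0 : ∀ ω, x 0 ω = x₀) (hx : ∀ k ω, IsSweep H g (σ k ω) (x k ω) (x (k + 1) ω)) (k : ℕ)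
    {ω ω' : Ω} (h : ∀ j < k, σ j ω = σ j ω') : x k ω = x k ω' := by
  induction k with
  | zero => rw [hx0, hx0]
  | succ k ih =>
    have h1 := hx k ω
    rw [h k (Nat.lt_succ_self k), ih fun j hj => h j (by omega)] at h1
    exact h1.unique hH hHii (hx k ω')

/-- By uniqueness of sweeps, `x k` is a function of the first `k` permutations, which range over a
finite discrete space. -/
lemma stronglyMeasurable_iterate (hH : H.PosSemidef)
    (hHii : ∀ i : Fin n, (diagBlock H i).PosDef) {Ω : Type*} [MeasurableSpace Ω]
    {σ : ℕ → Ω → Equiv.Perm (Fin n)} (hσ : ∀ k, Measurable[_, ⊤] (σ k)) {x₀ : BlockVec d}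
    {x : ℕ → Ω → BlockVec d} (hx0 : ∀ ω, x 0 ω = x₀)
    (hx : ∀ k ω, IsSweep H g (σ k ω) (x k ω) (x (k + 1) ω)) (k : ℕ) :
    StronglyMeasurable (x k) := by
  let _ : MeasurableSpace (Equiv.Perm (Fin n)) := ⊤
  have _ : DiscreteMeasurableSpace (Equiv.Perm (Fin n)) := ⟨fun _ => trivial⟩
  set s : Ω → Fin k → Equiv.Perm (Fin n) := fun ω j => σ j ω
  have hs : Measurable s := measurable_pi_lambda _ fun j => hσ j
  have hfac : Function.FactorsThrough (x k) s := fun ω ω' h =>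
    iterate_eq_of_perms_eq hH hHii hx0 hx k fun j hj => congrFun h ⟨j, hj⟩
  have heq : x k = Function.extend s (x k) 0 ∘ s :=
    funext fun ω => (hfac.extend_apply 0 ω).symm
  rw [heq]
  exact (Measurable.of_discrete.comp hs).stronglyMeasurable

/-- The gradient, and hence optimality, commutes with expectations. -/
lemma isOptimal_integral (hH : H.PosSemidef) {Ω : Type*} [MeasurableSpace Ω] (P : Measure Ω)
    [IsProbabilityMeasure P] {y : Ω → BlockVec d} (hint : Integrable y P)
    (hy : ∀ ω, IsOptimal H g (y ω)) : IsOptimal H g (∫ ω, y ω ∂P) := by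
  let L : BlockVec d →ₗ[ℝ] Idx d → ℝ :=
    { toFun := fun v => H *ᵥ flat v
      map_add' := fun v w => by rw [flat_add, Matrix.mulVec_add]
      map_smul' := fun t v => by rw [flat_smul, Matrix.mulVec_smul]; rfl }
  have hL : ∀ ω, L.toContinuousLinearMap (y ω) = -flat g := fun ω =>
    eq_neg_of_add_eq_zero_left ((isOptimal_iff_grad_eq_zero hH).1 (hy ω))
  have h1 := L.toContinuousLinearMap.integral_comp_comm hint
  simp only [hL, integral_const, probReal_univ, one_smul] at h1
  rw [isOptimal_iff_grad_eq_zero hH]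
  have h2 : H *ᵥ flat (∫ ω, y ω ∂P) = -flat g := h1.symm
  rw [grad, h2, neg_add_cancel]

end Iterates

end RPBCD

theorem corollary3p1 {n : ℕ} (d : Fin n → ℕ)
    (H : Matrix (RPBCD.Idx d) (RPBCD.Idx d) ℝ) (g : RPBCD.BlockVec d)
    (hH : H.PosSemidef)
    (hHii : ∀ i : Fin n, (RPBCD.diagBlock H i).PosDef)
    (hopt : ∃ x : RPBCD.BlockVec d, RPBCD.IsOptimal H g x)
    {Ω : Type*} [MeasurableSpace Ω] (P : Measure Ω) [IsProbabilityMeasure P]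
    (σ : ℕ → Ω → Equiv.Perm (Fin n)) (x₀ : RPBCD.BlockVec d)
    (x : ℕ → Ω → RPBCD.BlockVec d)
    (hx : RPBCD.IsRPBCD H g P σ x₀ x) :
    (∀ k, Integrable (x k) P) ∧
      ∃ xstar : RPBCD.BlockVec d, RPBCD.IsOptimal H g xstar ∧
        Tendsto (fun k => ∫ ω, x k ω ∂P) atTop (𝓝 xstar) := by
  obtain ⟨A, r, hA, hr0, hr, hrate⟩ := RPBCD.exists_geometric_rate hH hHii hopt x₀
  have hpath := fun ω => hrate (fun k => σ k ω) (fun k => x k ω) (hx.init ω) fun k => hx.step k ω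
  choose xlim hxopt hxlim using fun ω => (hpath ω).2
  have hmeas := RPBCD.stronglyMeasurable_iterate hH hHii hx.perms.measurable hx.init hx.step
  -- Both `x₀` and `x k ω` lie within the geometric sum `A / (1 - r)` of the limit, whence the
  -- factor 2.
  have hbound : ∀ k ω, ‖x k ω‖ ≤ ‖x₀‖ + 2 * (A / (1 - r)) := fun k ω => by
    have h0 : dist x₀ (xlim ω) ≤ A / (1 - r) := by
      simpa [hx.init] using dist_le_of_le_geometric_of_tendsto₀ r A hr (hpath ω).1 (hxlim ω)
    have hk : dist (x k ω) (xlim ω) ≤ A / (1 - r) :=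
      (dist_le_of_le_geometric_of_tendsto r A hr (hpath ω).1 (hxlim ω) k).trans
        (div_le_div_of_nonneg_right (mul_le_of_le_one_right hA (pow_le_one₀ hr0 hr.le))
          (sub_nonneg.2 hr.le))
    have htri := dist_triangle_right (x k ω) x₀ (xlim ω)
    have hnorm := norm_le_norm_add_norm_sub' (x k ω) x₀
    rw [← dist_eq_norm] at hnorm
    linarith
  have hlimint : Integrable xlim P :=
    Integrable.of_bound
      (stronglyMeasurable_of_tendsto atTop hmeas (tendsto_pi_nhds.2 hxlim)).aestronglyMeasurable _
      (ae_of_all _ fun ω => le_of_tendsto' (hxlim ω).norm fun k => hbound k ω)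
  refine ⟨fun k => Integrable.of_bound (hmeas k).aestronglyMeasurable _ (ae_of_all _ (hbound k)),
    ∫ ω, xlim ω ∂P, RPBCD.isOptimal_integral hH P hlimint hxopt, ?_⟩
  exact tendsto_integral_of_dominated_convergence _ (fun k => (hmeas k).aestronglyMeasurable)
    (integrable_const _) (fun k => ae_of_all _ (hbound k)) (ae_of_all _ hxlim)
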